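/- Let $\alpha>0$ be rational, let $K\ge 1$ be an integer with $\beta=K\alpha\le 1$, let $A=\begin{pmatrix}a_1&a_2\\ b_1&b_2\end{pmatrix}$ be a real matrix and $z=(z_1,z_2)^\top\in\mathbb R^2$. Consider the mixed-index problem $$D_t^{\alpha}y_1=a_1y_1+a_2y_2,\qquad D_t^{\beta}y_2=b_1y_1+b_2y_2\quad(t>0),\qquad y(0)=z,$$ where $D_t^{\gamma}f(t)=\frac1{\Gamma(1-\gamma)}\int_0^t\frac{f'(s)}{(t-s)^{\gamma}}\,ds$ for $0<\gamma<1$ is the Caputo derivative, $D_t^1f=f'$, and a solution is a function $y:[0,\infty)\to\mathbb R^2$ that is absolutely continuous on every $[0,T]$ and for which both derivatives exist (for $\gamma<1$: the integral converges absolutely) and both equations hold at every $t>0$. Let $E_\alpha(x)=\sum_{j\ge0}x^j/\Gamma(1+j\alpha)$, and factorise over $\mathbb C$, with $w$ standing for $s^\alpha$, $$D(w)=w^{K+1}-a_1w^K-b_2w+\det A=\prod_{j=1}^{K+1}(w-\lambda_j).$$ Such a factorisation exists. Let $\lambda_1,\dots,\lambda_{K+1}$ be any such list of the roots with multiplicity,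 and consider the partial-fraction expansion $$\sum_{j=1}^{K+1}\frac{A_j}{w-\lambda_j}=\frac1{D(w)}\left(w^Kz+\begin{pmatrix}a_2\\-a_1\end{pmatrix}w^{K-1}z_2+\begin{pmatrix}-b_2\\b_1\end{pmatrix}z_1\right)\qquad(w\in\mathbb C,\ D(w)\ne0).\tag{$*$}$$ If the $\lambda_j$ are pairwise distinct, there is exactly one family of vectors $A_1,\dots,A_{K+1}\in\mathbb C^2$ satisfying $(*)$. Whenever vectors $A_j\in\mathbb C^2$ satisfy $(*)$ (whether or not the $\lambda_j$ are distinct), the mixed-index problem has exactly one solution on $[0,\infty)$, and it is $$y(t)=\sum_{j=1}^{K+1}A_j\,E_\alpha(\lambda_jt^\alpha),\qquad t\ge0.$$ -/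

import Mathlib

open Polynomial

noncomputable section

/-- The one-parameter Mittag-Leffler function `E_α(z) = ∑_{j ≥ 0} z ^ j / Γ(1 + j α)`
(the series converges for every complex `z` when `0 < α`). -/
def mittagLeffler (α : ℝ) (z : ℂ) : ℂ :=
  ∑' j : ℕ, z ^ j / ((Real.Gamma (1 + (j : ℝ) * α) : ℝ) : ℂ)

/-- The Caputo derivative of order `γ ∈ (0, 1]` with starting point `0`:
`(1 / Γ(1 - γ)) ∫_0^t f'(s) / (t - s) ^ γ ds` for `0 < γ < 1`, and `f'(t)` for `γ = 1`. -/
def caputoDeriv (γ : ℝ) (f : ℝ → ℝ) (t : ℝ) : ℝ :=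
  if γ = 1 then deriv f t
  else (1 / Real.Gamma (1 - γ)) * ∫ s in (0 : ℝ)..t, deriv f s / (t - s) ^ γ

/-- The Caputo derivative of order `γ` of `f` exists at `t`: the integral defining it converges
absolutely (for `γ < 1`), respectively `f` is differentiable at `t` (for `γ = 1`).
To be used together with local absolute continuity of `f`. -/
def CaputoDerivExists (γ : ℝ) (f : ℝ → ℝ) (t : ℝ) : Prop :=
  if γ = 1 then DifferentiableAt ℝ f t
  else IntervalIntegrable (fun s => deriv f s / (t - s) ^ γ) MeasureTheory.volume 0 t

/-- `y` solves on `[0, ∞)` the scalar mixed index-2 problem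
`D^{γ₀} y₀ = A₀₀ y₀ + A₀₁ y₁`, `D^{γ₁} y₁ = A₁₀ y₀ + A₁₁ y₁`, `y(0) = z`,
where both components are absolutely continuous on every `[0, T]`, and both Caputo derivatives
exist and satisfy the equation at every `t > 0`. -/
structure IsMixedIndexSolution (γ : Fin 2 → ℝ) (A : Matrix (Fin 2) (Fin 2) ℝ) (z : Fin 2 → ℝ)
    (y : ℝ → Fin 2 → ℝ) : Prop where
  initial : y 0 = z
  absolutelyContinuous :
    ∀ i, ∀ T : ℝ, 0 ≤ T → AbsolutelyContinuousOnInterval (fun t => y t i) 0 T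
  derivExists : ∀ i, ∀ t : ℝ, 0 < t → CaputoDerivExists (γ i) (fun s => y s i) t
  equation : ∀ i, ∀ t : ℝ, 0 < t → caputoDeriv (γ i) (fun s => y s i) t = A.mulVec (y t) i

/-- The polynomial `w ^ (K + 1) - a₁ w ^ K - b₂ w + det A` for `A = (a₁, a₂; b₁, b₂)`; it is
`Det(s) = s ^ (α + β) - a₁ s ^ β - b₂ s ^ α + det A` in the variable `w = s ^ α`
when `β = K α`. -/
def detPoly (A : Matrix (Fin 2) (Fin 2) ℝ) (K : ℕ) : ℂ[X] :=
  X ^ (K + 1) - C (A 0 0 : ℂ) * X ^ K - C (A 1 1 : ℂ) * X + C (A.det : ℂ)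

/-- `lam 0, …, lam K` are the roots of `detPoly A K`, listed with multiplicity. -/
def IsRootList (A : Matrix (Fin 2) (Fin 2) ℝ) (K : ℕ) (lam : Fin (K + 1) → ℂ) : Prop :=
  detPoly A K = ∏ j, (X - C (lam j))

/-- The partial fraction expansion, in the variable `w = s ^ α`, that the vectors `c j` satisfy:
`∑_j c_j / (w - λ_j)` equals
`(w ^ K z + w ^ (K - 1) z₁ (a₂, -a₁) + z₀ (-b₂, b₁)) / Det(w)`
for `A = (a₁, a₂; b₁, b₂)`, as rational functions of `w`, that is, at every `w` that is not a
root of the denominator. -/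
def IsPartialFraction (A : Matrix (Fin 2) (Fin 2) ℝ) (z : Fin 2 → ℝ) (K : ℕ)
    (lam : Fin (K + 1) → ℂ) (c : Fin (K + 1) → Fin 2 → ℂ) : Prop :=
  ∀ w : ℂ, (detPoly A K).eval w ≠ 0 →
    ∑ j, (1 / (w - lam j)) • c j =
      (1 / (detPoly A K).eval w) •
        ((w ^ K) • ![(z 0 : ℂ), (z 1 : ℂ)]
          + (w ^ (K - 1) * (z 1 : ℂ)) • ![(A 0 1 : ℂ), -(A 0 0 : ℂ)]
          + (z 0 : ℂ) • ![-(A 1 1 : ℂ), (A 1 0 : ℂ)])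

end

/-!
Fractional integration turns each Caputo equation into the Volterra equation
`yᵢ = zᵢ + I^{γᵢ} (A y)ᵢ`. Its solution is unique: for large `ρ` the Volterra operator halves the
supremum of `exp (-ρ t) ‖y t‖`.

A solution is sought as `∑ mₙ t ^ (n α) / Γ(1 + n α)`. Integration of order `k α` shifts `n` by
`k`, so the equations become a recurrence for the vectors `mₙ`. On the other side,
`∑ cⱼ E_α(λⱼ t ^ α)` has the coefficients `mₙ = ∑ cⱼ λⱼ ^ n`, which are also the coefficients of the
expansion of `∑ cⱼ / (w - λⱼ)` at `w = ∞`. The right-hand side of the partial fraction expansion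
solves the Laplace transformed system, and comparing coefficients at `w = ∞` in that system gives
exactly the recurrence. The recurrence has real data, so the `mₙ` are real.
-/

section FracIntegral

open MeasureTheory Set

theorem integral_integral_triangle {E : Type*} [NormedAddCommGroup E] [NormedSpace ℝ E]
    {F : ℝ → ℝ → E} {a b : ℝ} (hab : a ≤ b)
    (hF : IntegrableOn (Function.uncurry F) {p | p.2 < p.1}
      ((volume.restrict (Ioo a b)).prod (volume.restrict (Ioo a b)))) :
    ∫ s in a..b, ∫ r in a..s, F s r = ∫ r in a..b, ∫ s in r..b, F s r := by
  have hlower : ∀ s ∈ Ioo a b,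
      ∫ r in a..s, F s r = ∫ r in Ioo a b, (Iio s).indicator (F s) r := fun s hs => by
    have hinter : Ioo a b ∩ Iio s = Ioo a s := by grind
    rw [setIntegral_indicator measurableSet_Iio, hinter, intervalIntegral.integral_of_le hs.1.le,
      integral_Ioc_eq_integral_Ioo]
  have hupper : ∀ r ∈ Ioo a b,
      ∫ s in r..b, F s r = ∫ s in Ioo a b, (Ioi r).indicator (F · r) s := fun r hr => by
    have hinter : Ioo a b ∩ Ioi r = Ioo r b := by grind
    rw [setIntegral_indicator measurableSet_Ioi, hinter, intervalIntegral.integral_of_le hr.2.le,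
      integral_Ioc_eq_integral_Ioo]
  rw [intervalIntegral.integral_of_le hab, intervalIntegral.integral_of_le hab,
    integral_Ioc_eq_integral_Ioo, integral_Ioc_eq_integral_Ioo,
    setIntegral_congr_fun measurableSet_Ioo hlower,
    setIntegral_congr_fun measurableSet_Ioo hupper]
  exact integral_integral_swap
    ((integrable_indicator_iff (measurableSet_lt measurable_snd measurable_fst)).mpr hF)

theorem integral_sub_rpow_mul_sub_rpow {a b r t : ℝ} (ha : 0 < a) (hb : 0 < b) (hrt : r < t) :
    ∫ s in r..t, (t - s) ^ (a - 1) * (s - r) ^ (b - 1) =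
      Real.Gamma a * Real.Gamma b / Real.Gamma (a + b) * (t - r) ^ (a + b - 1) := by
  have hbeta := Complex.betaIntegral_scaled b a (sub_pos.mpr hrt)
  rw [Complex.betaIntegral_eq_Gamma_mul_div _ _ (by simpa) (by simpa)] at hbeta
  have hshift := intervalIntegral.integral_comp_sub_right (a := r) (b := t)
    (fun u => (t - r - u) ^ (a - 1) * u ^ (b - 1)) r
  simp only [sub_sub_sub_cancel_right, sub_self] at hshift
  rw [hshift, ← Complex.ofReal_inj, ← intervalIntegral.integral_ofReal]
  refine Eq.trans (intervalIntegral.integral_congr fun u hu => ?_) (hbeta.trans ?_)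
  · rw [uIcc_of_le (sub_nonneg.mpr hrt.le)] at hu
    rw [Complex.ofReal_mul, Complex.ofReal_cpow hu.1, Complex.ofReal_cpow (sub_nonneg.mpr hu.2)]
    push_cast
    exact mul_comm _ _
  · rw [Complex.ofReal_mul, Complex.ofReal_cpow (sub_nonneg.mpr hrt.le), ← Complex.ofReal_add]
    simp only [Complex.Gamma_ofReal]
    push_cast
    ring_nf

theorem intervalIntegrable_sub_rpow_mul_sub_rpow {a b r t : ℝ} (ha : 0 < a) (hb : 0 < b)
    (hrt : r < t) :
    IntervalIntegrable (fun s => (t - s) ^ (a - 1) * (s - r) ^ (b - 1)) volume r t := by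
  refine intervalIntegral.intervalIntegrable_of_integral_ne_zero ?_
  rw [integral_sub_rpow_mul_sub_rpow ha hb hrt]
  have := Real.Gamma_pos_of_pos ha
  have := Real.Gamma_pos_of_pos hb
  have := Real.Gamma_pos_of_pos (add_pos ha hb)
  have := sub_pos.mpr hrt
  positivity

theorem integral_norm_sub_rpow_mul_sub_rpow_mul {a b r t : ℝ} (ha : 0 < a) (hb : 0 < b)
    (hrt : r < t) (c : ℝ) :
    ∫ s in Ioo r t, ‖(t - s) ^ (a - 1) * ((s - r) ^ (b - 1) * c)‖ =
      Real.Gamma a * Real.Gamma b / Real.Gamma (a + b) * ‖(t - r) ^ (a + b - 1) * c‖ := by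
  have hnorm : ∀ s ∈ Ioo r t, ‖(t - s) ^ (a - 1) * ((s - r) ^ (b - 1) * c)‖ =
      (t - s) ^ (a - 1) * (s - r) ^ (b - 1) * ‖c‖ := fun s hs => by
    rw [norm_mul, norm_mul, Real.norm_of_nonneg (Real.rpow_nonneg (sub_nonneg.mpr hs.2.le) _),
      Real.norm_of_nonneg (Real.rpow_nonneg (sub_nonneg.mpr hs.1.le) _), mul_assoc]
  rw [setIntegral_congr_fun measurableSet_Ioo hnorm, integral_mul_const,
    ← integral_Ioc_eq_integral_Ioo, ← intervalIntegral.integral_of_le hrt.le,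
    integral_sub_rpow_mul_sub_rpow ha hb hrt, norm_mul,
    Real.norm_of_nonneg (Real.rpow_nonneg (sub_nonneg.mpr hrt.le) _), mul_assoc]

theorem intervalIntegrable_sub_rpow_mul {a t : ℝ} (ha : 0 < a) (ht : 0 ≤ t) {g : ℝ → ℝ}
    (hg : ContinuousOn g (Icc 0 t)) :
    IntervalIntegrable (fun s => (t - s) ^ (a - 1) * g s) volume 0 t := by
  rcases ht.eq_or_lt with rfl | ht
  · exact IntervalIntegrable.refl
  · have hkernel := intervalIntegrable_sub_rpow_mul_sub_rpow ha one_pos ht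
    simp only [sub_self, Real.rpow_zero, mul_one] at hkernel
    exact hkernel.mul_continuousOn (by rwa [uIcc_of_le ht.le])

theorem integrableOn_triangle_sub_rpow_mul {a b t : ℝ} (ha : 0 < a) (hb : 0 < b) (ht : 0 ≤ t)
    {φ : ℝ → ℝ} (hφ : IntervalIntegrable (fun r => (t - r) ^ (a + b - 1) * φ r) volume 0 t) :
    IntegrableOn
      (Function.uncurry fun s r => (t - s) ^ (a - 1) * ((s - r) ^ (b - 1) * φ r))
      {p | p.2 < p.1} ((volume.restrict (Ioo 0 t)).prod (volume.restrict (Ioo 0 t))) := by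
  have hS : MeasurableSet {p : ℝ × ℝ | p.2 < p.1} := measurableSet_lt measurable_snd measurable_fst
  have hφ' := (intervalIntegrable_iff_integrableOn_Ioo_of_le ht).mp hφ
  have hφm : AEStronglyMeasurable φ (volume.restrict (Ioo 0 t)) := by
    have hinv : Measurable fun r : ℝ => ((t - r) ^ (a + b - 1))⁻¹ := by fun_prop
    refine (hinv.aestronglyMeasurable.mul hφ'.aestronglyMeasurable).congr ?_
    filter_upwards [ae_restrict_mem measurableSet_Ioo] with r hr
    exact inv_mul_cancel_left₀ (Real.rpow_pos_of_pos (sub_pos.mpr hr.2) _).ne' _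
  have hmeas : AEStronglyMeasurable
      (Function.uncurry fun s r => (t - s) ^ (a - 1) * ((s - r) ^ (b - 1) * φ r))
      ((volume.restrict (Ioo 0 t)).prod (volume.restrict (Ioo 0 t))) := by
    have h₁ : Measurable fun p : ℝ × ℝ => (t - p.1) ^ (a - 1) := by fun_prop
    have h₂ : Measurable fun p : ℝ × ℝ => (p.1 - p.2) ^ (b - 1) := by fun_prop
    exact h₁.aestronglyMeasurable.mul (h₂.aestronglyMeasurable.mul hφm.comp_snd)
  have hslice : ∀ r ∈ Ioo 0 t, Ioi r ∩ Ioo 0 t = Ioo r t := by grind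
  rw [← integrable_indicator_iff hS, integrable_prod_iff' (hmeas.indicator hS)]
  constructor
  · filter_upwards [ae_restrict_mem measurableSet_Ioo] with r hr
    have hkernel := (intervalIntegrable_iff_integrableOn_Ioo_of_le hr.2.le).mp
      (intervalIntegrable_sub_rpow_mul_sub_rpow ha hb hr.2)
    refine (integrable_indicator_iff (s := Ioi r) measurableSet_Ioi).mpr ?_
    rw [IntegrableOn, Measure.restrict_restrict measurableSet_Ioi, hslice r hr]
    simpa only [Function.uncurry_apply_pair, mul_assoc] using hkernel.mul_const (φ r)
  · refine (hφ'.norm.const_mul (Real.Gamma a * Real.Gamma b / Real.Gamma (a + b))).congr ?_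
    filter_upwards [ae_restrict_mem measurableSet_Ioo] with r hr
    calc _ = ∫ s in Ioo r t, ‖(t - s) ^ (a - 1) * ((s - r) ^ (b - 1) * φ r)‖ :=
          (integral_norm_sub_rpow_mul_sub_rpow_mul ha hb hr.2 (φ r)).symm
      _ = ∫ s in Ioo 0 t, (Ioi r).indicator
            (fun s => ‖(t - s) ^ (a - 1) * ((s - r) ^ (b - 1) * φ r)‖) s := by
          rw [integral_indicator measurableSet_Ioi, Measure.restrict_restrict measurableSet_Ioi,
            hslice r hr]
      _ = _ := by simp only [norm_indicator_eq_indicator_norm]; rfl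

/-- The Riemann–Liouville integral of order `γ` with starting point `0`. Caputo derivatives invert
it, which turns a fractional initial value problem into an integral equation. -/
noncomputable def fracIntegral (γ : ℝ) (f : ℝ → ℝ) (t : ℝ) : ℝ :=
  (Real.Gamma γ)⁻¹ * ∫ s in (0 : ℝ)..t, (t - s) ^ (γ - 1) * f s

theorem fracIntegral_one (f : ℝ → ℝ) (t : ℝ) : fracIntegral 1 f t = ∫ s in (0 : ℝ)..t, f s := by
  simp [fracIntegral]

theorem fracIntegral_congr {γ t : ℝ} {f g : ℝ → ℝ} (ht : 0 ≤ t) (hfg : ∀ s ∈ Ioc 0 t, f s = g s) :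
    fracIntegral γ f t = fracIntegral γ g t := by
  rw [fracIntegral, fracIntegral]
  congr 1
  refine intervalIntegral.integral_congr_ae (Filter.Eventually.of_forall fun s hs => ?_)
  rw [uIoc_of_le ht] at hs
  rw [hfg s hs]

theorem fracIntegral_const_mul (γ c : ℝ) (f : ℝ → ℝ) (t : ℝ) :
    fracIntegral γ (fun s => c * f s) t = c * fracIntegral γ f t := by
  simp only [fracIntegral, mul_left_comm _ c, intervalIntegral.integral_const_mul]

theorem fracIntegral_fracIntegral {a b t : ℝ} (ha : 0 < a) (hb : 0 < b) (ht : 0 ≤ t) {φ : ℝ → ℝ}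
    (hφ : IntervalIntegrable (fun r => (t - r) ^ (a + b - 1) * φ r) volume 0 t) :
    fracIntegral a (fracIntegral b φ) t = fracIntegral (a + b) φ t := by
  have hinner : ∫ r in (0 : ℝ)..t, ∫ s in r..t, (t - s) ^ (a - 1) * ((s - r) ^ (b - 1) * φ r) =
      Real.Gamma a * Real.Gamma b / Real.Gamma (a + b) *
        ∫ r in (0 : ℝ)..t, (t - r) ^ (a + b - 1) * φ r := by
    rw [← intervalIntegral.integral_const_mul, intervalIntegral.integral_of_le ht,
      intervalIntegral.integral_of_le ht, integral_Ioc_eq_integral_Ioo,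
      integral_Ioc_eq_integral_Ioo]
    refine setIntegral_congr_fun measurableSet_Ioo fun r hr => ?_
    simp only [← mul_assoc]
    rw [intervalIntegral.integral_mul_const, integral_sub_rpow_mul_sub_rpow ha hb hr.2]
  have ha' := (Real.Gamma_pos_of_pos ha).ne'
  have hb' := (Real.Gamma_pos_of_pos hb).ne'
  calc fracIntegral a (fracIntegral b φ) t
      = (Real.Gamma a)⁻¹ * (Real.Gamma b)⁻¹ *
          ∫ s in (0 : ℝ)..t, ∫ r in (0 : ℝ)..s, (t - s) ^ (a - 1) * ((s - r) ^ (b - 1) * φ r) := by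
        simp only [fracIntegral, mul_left_comm _ (Real.Gamma b)⁻¹,
          intervalIntegral.integral_const_mul, mul_assoc]
    _ = fracIntegral (a + b) φ t := by
        rw [integral_integral_triangle ht (integrableOn_triangle_sub_rpow_mul ha hb ht hφ), hinner,
          fracIntegral]
        field_simp

theorem caputoDeriv_one (f : ℝ → ℝ) : caputoDeriv 1 f = deriv f := by
  ext t
  exact if_pos rfl

theorem caputoDeriv_eq_fracIntegral {γ t : ℝ} (hγ : γ ≠ 1) (ht : 0 ≤ t) (f : ℝ → ℝ) :
    caputoDeriv γ f t = fracIntegral (1 - γ) (deriv f) t := by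
  rw [caputoDeriv, if_neg hγ, fracIntegral, one_div]
  congr 1
  refine intervalIntegral.integral_congr fun s hs => ?_
  rw [uIcc_of_le ht] at hs
  rw [sub_sub_cancel_left, Real.rpow_neg (sub_nonneg.mpr hs.2), div_eq_inv_mul]

theorem fracIntegral_caputoDeriv {γ t : ℝ} (hγ : 0 < γ) (hγ1 : γ ≤ 1) (ht : 0 ≤ t) {f : ℝ → ℝ}
    (hf : AbsolutelyContinuousOnInterval f 0 t) :
    fracIntegral γ (caputoDeriv γ f) t = f t - f 0 := by
  rcases hγ1.eq_or_lt with rfl | hγ1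
  · rw [caputoDeriv_one, fracIntegral_one, hf.integral_deriv_eq_sub]
  · have hadd : γ + (1 - γ) = 1 := add_sub_cancel γ 1
    rw [fracIntegral_congr ht fun s hs => caputoDeriv_eq_fracIntegral hγ1.ne hs.1.le f,
      fracIntegral_fracIntegral hγ (sub_pos.mpr hγ1) ht
        (by simpa using hf.intervalIntegrable_deriv),
      hadd, fracIntegral_one, hf.integral_deriv_eq_sub]

theorem abs_fracIntegral_le_of_abs_le {γ t : ℝ} (hγ : 0 < γ) (ht : 0 ≤ t) {f g : ℝ → ℝ}
    (hg : ContinuousOn g (Icc 0 t)) (hfg : ∀ s ∈ Ioc 0 t, |f s| ≤ g s) :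
    |fracIntegral γ f t| ≤ fracIntegral γ g t := by
  have hΓ := Real.Gamma_pos_of_pos hγ
  rw [fracIntegral, fracIntegral, abs_mul, abs_of_pos (inv_pos.mpr hΓ)]
  refine mul_le_mul_of_nonneg_left ?_ (inv_pos.mpr hΓ).le
  rw [← Real.norm_eq_abs]
  refine intervalIntegral.norm_integral_le_of_norm_le ht
    (Filter.Eventually.of_forall fun s hs => ?_) (intervalIntegrable_sub_rpow_mul hγ ht hg)
  have hpow : 0 ≤ (t - s) ^ (γ - 1) := Real.rpow_nonneg (sub_nonneg.mpr hs.2) _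
  rw [norm_mul, Real.norm_of_nonneg hpow]
  exact mul_le_mul_of_nonneg_left (hfg s hs) hpow

theorem fracIntegral_sub {γ t : ℝ} (hγ : 0 < γ) (ht : 0 ≤ t) {f g : ℝ → ℝ}
    (hf : ContinuousOn f (Icc 0 t)) (hg : ContinuousOn g (Icc 0 t)) :
    fracIntegral γ (fun s => f s - g s) t = fracIntegral γ f t - fracIntegral γ g t := by
  simp only [fracIntegral, mul_sub]
  rw [intervalIntegral.integral_sub (intervalIntegrable_sub_rpow_mul hγ ht hf)
    (intervalIntegrable_sub_rpow_mul hγ ht hg), mul_sub]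

theorem fracIntegral_exp_le {γ ρ t : ℝ} (hγ : 0 < γ) (hρ : 0 < ρ) (ht : 0 ≤ t) :
    fracIntegral γ (fun s => Real.exp (ρ * s)) t ≤ Real.exp (ρ * t) / ρ ^ γ := by
  have := Real.Gamma_pos_of_pos hγ
  have hlaplace := Real.integral_rpow_mul_exp_neg_mul_Ioi hγ hρ
  have hint : IntegrableOn (fun u : ℝ => u ^ (γ - 1) * Real.exp (-(ρ * u))) (Ioi 0) :=
    not_imp_comm.mp integral_undef (by rw [hlaplace]; positivity)
  have hreflect : ∫ s in (0 : ℝ)..t, (t - s) ^ (γ - 1) * Real.exp (ρ * s) =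
      Real.exp (ρ * t) * ∫ u in (0 : ℝ)..t, u ^ (γ - 1) * Real.exp (-(ρ * u)) := by
    have hsubst := intervalIntegral.integral_comp_sub_left (a := 0) (b := t)
      (fun u => u ^ (γ - 1) * Real.exp (-(ρ * u))) t
    rw [sub_self, sub_zero] at hsubst
    rw [← hsubst, ← intervalIntegral.integral_const_mul]
    refine intervalIntegral.integral_congr fun s _ => ?_
    rw [mul_left_comm, ← Real.exp_add]
    ring_nf
  have hle : ∫ u in (0 : ℝ)..t, u ^ (γ - 1) * Real.exp (-(ρ * u)) ≤
      (1 / ρ) ^ γ * Real.Gamma γ := by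
    rw [← hlaplace, intervalIntegral.integral_of_le ht]
    refine setIntegral_mono_set hint ?_ (Filter.Eventually.of_forall fun u hu => hu.1)
    filter_upwards [ae_restrict_mem measurableSet_Ioi] with u hu
    exact mul_nonneg (Real.rpow_nonneg (le_of_lt hu) _) (Real.exp_pos _).le
  calc fracIntegral γ (fun s => Real.exp (ρ * s)) t
      ≤ (Real.Gamma γ)⁻¹ * (Real.exp (ρ * t) * ((1 / ρ) ^ γ * Real.Gamma γ)) := by
        rw [fracIntegral, hreflect]
        gcongr
    _ = Real.exp (ρ * t) / ρ ^ γ := by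
        rw [one_div, Real.inv_rpow hρ.le]
        field_simp

end FracIntegral

section Uniqueness

open Set

theorem norm_le_half_of_abs_le_fracIntegral {ι : Type*} [Fintype ι] {γ : ι → ℝ}
    (hγ : ∀ i, 0 < γ i) {L W ρ T : ℝ} (hL : 0 ≤ L) (hW : 0 ≤ W) (hρ : 0 < ρ)
    (hLρ : ∀ i, 2 * L ≤ ρ ^ γ i) {d : ℝ → ι → ℝ}
    (hd : ∀ i, ∀ t ∈ Icc 0 T, |d t i| ≤ L * fracIntegral (γ i) (fun s => ‖d s‖) t)
    (hdW : ∀ t ∈ Icc 0 T, ‖d t‖ ≤ W * Real.exp (ρ * t)) {t : ℝ} (ht : t ∈ Icc 0 T) :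
    ‖d t‖ ≤ W / 2 * Real.exp (ρ * t) := by
  refine (pi_norm_le_iff_of_nonneg (by positivity)).mpr fun i => ?_
  calc |d t i| ≤ L * fracIntegral (γ i) (fun s => ‖d s‖) t := hd i t ht
    _ ≤ L * fracIntegral (γ i) (fun s => W * Real.exp (ρ * s)) t := by
        refine mul_le_mul_of_nonneg_left ((le_abs_self _).trans ?_) hL
        refine abs_fracIntegral_le_of_abs_le (hγ i) ht.1 (by fun_prop) fun s hs => ?_
        rw [abs_norm]
        exact hdW s ⟨hs.1.le, hs.2.trans ht.2⟩
    _ ≤ L * (W * (Real.exp (ρ * t) / ρ ^ γ i)) := by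
        rw [fracIntegral_const_mul]
        gcongr
        exact fracIntegral_exp_le (hγ i) hρ ht.1
    _ = L / ρ ^ γ i * (W * Real.exp (ρ * t)) := by ring
    _ ≤ 1 / 2 * (W * Real.exp (ρ * t)) := by
        refine mul_le_mul_of_nonneg_right ?_ (by positivity)
        rw [div_le_div_iff₀ (by positivity) two_pos]
        linarith [hLρ i]
    _ = W / 2 * Real.exp (ρ * t) := by ring

theorem eq_zero_of_abs_le_fracIntegral {ι : Type*} [Fintype ι] {γ : ι → ℝ} (hγ : ∀ i, 0 < γ i)
    {L T : ℝ} (hL : 0 ≤ L) {d : ℝ → ι → ℝ} (hcont : ContinuousOn d (Icc 0 T))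
    (hd : ∀ i, ∀ t ∈ Icc 0 T, |d t i| ≤ L * fracIntegral (γ i) (fun s => ‖d s‖) t)
    {t : ℝ} (ht : t ∈ Icc 0 T) :
    d t = 0 := by
  obtain ⟨ρ, hρ, hLρ⟩ : ∃ ρ : ℝ, 0 < ρ ∧ ∀ i, 2 * L ≤ ρ ^ γ i :=
    ((Filter.eventually_gt_atTop 0).and (Filter.eventually_all.mpr fun i =>
      (tendsto_rpow_atTop (hγ i)).eventually_ge_atTop (2 * L))).exists
  have hweight : ContinuousOn (fun t => ‖d t‖ / Real.exp (ρ * t)) (Icc 0 T) :=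
    hcont.norm.div (by fun_prop) fun _ _ => (Real.exp_pos _).ne'
  obtain ⟨t₀, ht₀, hmax⟩ := isCompact_Icc.exists_isMaxOn ⟨t, ht⟩ hweight
  set W := ‖d t₀‖ / Real.exp (ρ * t₀)
  have hdW : ∀ t ∈ Icc 0 T, ‖d t‖ ≤ W * Real.exp (ρ * t) := fun t ht =>
    (div_le_iff₀ (Real.exp_pos _)).mp (hmax ht)
  have hhalf : W ≤ W / 2 := (div_le_iff₀ (Real.exp_pos _)).mpr
    (norm_le_half_of_abs_le_fracIntegral hγ hL (by positivity) hρ hLρ hd hdW ht₀)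
  have hW0 : W ≤ 0 := by linarith
  refine norm_le_zero_iff.mp ((hdW t ht).trans ?_)
  exact mul_nonpos_of_nonpos_of_nonneg hW0 (Real.exp_pos _).le

namespace IsMixedIndexSolution

variable {γ : Fin 2 → ℝ} {A : Matrix (Fin 2) (Fin 2) ℝ} {z : Fin 2 → ℝ} {x y : ℝ → Fin 2 → ℝ}

theorem eq_add_fracIntegral (hy : IsMixedIndexSolution γ A z y) (hγ : ∀ i, 0 < γ i)
    (hγ1 : ∀ i, γ i ≤ 1) (i : Fin 2) {t : ℝ} (ht : 0 ≤ t) :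
    y t i = z i + fracIntegral (γ i) (fun s => A.mulVec (y s) i) t := by
  have hinv := fracIntegral_caputoDeriv (hγ i) (hγ1 i) ht (hy.absolutelyContinuous i t ht)
  rw [fracIntegral_congr ht fun s hs => hy.equation i s hs.1, hy.initial] at hinv
  rw [hinv, add_sub_cancel]

theorem continuousOn (hy : IsMixedIndexSolution γ A z y) {T : ℝ} (hT : 0 ≤ T) :
    ContinuousOn y (Icc 0 T) :=
  continuousOn_pi.mpr fun i => by
    simpa only [uIcc_of_le hT] using (hy.absolutelyContinuous i T hT).continuousOn

theorem eqOn (hx : IsMixedIndexSolution γ A z x) (hy : IsMixedIndexSolution γ A z y)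
    (hγ : ∀ i, 0 < γ i) (hγ1 : ∀ i, γ i ≤ 1) :
    EqOn x y (Ici 0) := by
  intro t (ht : 0 ≤ t)
  set Φ := LinearMap.toContinuousLinearMap A.mulVecLin
  have hmulVec : ∀ {u : ℝ → Fin 2 → ℝ}, IsMixedIndexSolution γ A z u → ∀ i, ∀ s, 0 ≤ s →
      ContinuousOn (fun r => A.mulVec (u r) i) (Icc 0 s) := fun hu i s hs =>
    (by fun_prop : Continuous fun v => A.mulVec v i).comp_continuousOn (hu.continuousOn hs)
  refine sub_eq_zero.mp (eq_zero_of_abs_le_fracIntegral hγ (norm_nonneg Φ)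
    (d := fun s => x s - y s) ((hx.continuousOn ht).sub (hy.continuousOn ht))
    (fun i s hs => ?_) ⟨ht, le_rfl⟩)
  have hd : ContinuousOn (fun r => x r - y r) (Icc 0 s) :=
    (hx.continuousOn hs.1).sub (hy.continuousOn hs.1)
  calc |(x s - y s) i|
      = |fracIntegral (γ i) (fun r => A.mulVec (x r - y r) i) s| := by
        rw [Pi.sub_apply, hx.eq_add_fracIntegral hγ hγ1 i hs.1,
          hy.eq_add_fracIntegral hγ hγ1 i hs.1, add_sub_add_left_eq_sub,
          ← fracIntegral_sub (hγ i) hs.1 (hmulVec hx i s hs.1) (hmulVec hy i s hs.1)]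
        simp only [Matrix.mulVec_sub, Pi.sub_apply]
    _ ≤ fracIntegral (γ i) (fun r => ‖Φ‖ * ‖x r - y r‖) s :=
        abs_fracIntegral_le_of_abs_le (hγ i) hs.1 (hd.norm.const_mul ‖Φ‖) fun r _ =>
          (norm_le_pi_norm (A.mulVec (x r - y r)) i).trans (Φ.le_opNorm _)
    _ = ‖Φ‖ * fracIntegral (γ i) (fun r => ‖x r - y r‖) s := fracIntegral_const_mul _ _ _ _

end IsMixedIndexSolution

end Uniqueness

section FracSeries

open MeasureTheory Set

theorem exists_mul_rpow_le_Gamma {M : ℝ} (hM : 0 < M) :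
    ∃ c > 0, ∀ y : ℝ, 0 < y → c * M ^ y ≤ Real.Gamma y := by
  refine ⟨Real.exp (-(M + 1)) / (M + 1), by positivity, fun y hy => ?_⟩
  rw [Real.Gamma_eq_integral hy]
  have hint := Real.GammaIntegral_convergent hy
  have hsub : Ioc M (M + 1) ⊆ Ioi 0 := fun x hx => hM.trans hx.1
  calc Real.exp (-(M + 1)) / (M + 1) * M ^ y
      = ∫ _ in Ioc M (M + 1), Real.exp (-(M + 1)) / (M + 1) * M ^ y := by simp
    _ ≤ ∫ x in Ioc M (M + 1), Real.exp (-x) * x ^ (y - 1) := by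
        refine setIntegral_mono_on (integrableOn_const (by simp)) (hint.mono_set hsub)
          measurableSet_Ioc fun x hx => ?_
        have hx0 : 0 < x := hM.trans hx.1
        have hxM : x ≤ M + 1 := hx.2
        rw [Real.rpow_sub_one hx0.ne', div_mul_eq_mul_div, mul_div_assoc]
        have hpow : M ^ y ≤ x ^ y := Real.rpow_le_rpow hM.le hx.1.le hy.le
        gcongr
    _ ≤ ∫ x in Ioi 0, Real.exp (-x) * x ^ (y - 1) := by
        refine setIntegral_mono_set hint ?_ (Filter.Eventually.of_forall hsub)
        filter_upwards [ae_restrict_mem measurableSet_Ioi] with x hx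
        exact mul_nonneg (Real.exp_pos _).le (Real.rpow_nonneg (le_of_lt hx) _)

theorem summable_pow_div_Gamma {α δ : ℝ} (hα : 0 < α) (hδ : 0 < δ) {x : ℝ} (hx : 0 ≤ x) :
    Summable fun n : ℕ => x ^ n / Real.Gamma (n * α + δ) := by
  set q := x + 1
  have hq : 0 < q := by positivity
  obtain ⟨c, hc, hcΓ⟩ := exists_mul_rpow_le_Gamma (Real.rpow_pos_of_pos hq α⁻¹)
  have hpow : ∀ n : ℕ, (q ^ α⁻¹) ^ (n * α + δ) = q ^ n * (q ^ α⁻¹) ^ δ := fun n => by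
    rw [Real.rpow_add (by positivity), ← Real.rpow_mul hq.le, mul_comm (n : ℝ) α, ← mul_assoc,
      inv_mul_cancel₀ hα.ne', one_mul, Real.rpow_natCast]
  have hratio : x / q < 1 := (div_lt_one hq).mpr (lt_add_one x)
  refine Summable.of_nonneg_of_le (fun n => ?_) (fun n => ?_)
    ((summable_geometric_of_lt_one (by positivity) hratio).mul_left (1 / (c * (q ^ α⁻¹) ^ δ)))
  · have := Real.Gamma_pos_of_pos (by positivity : (0 : ℝ) < n * α + δ)
    positivity
  · calc x ^ n / Real.Gamma (n * α + δ) ≤ x ^ n / (c * (q ^ α⁻¹) ^ (n * α + δ)) := by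
          gcongr
          exact hcΓ _ (by positivity)
      _ = 1 / (c * (q ^ α⁻¹) ^ δ) * (x / q) ^ n := by
          rw [hpow, div_pow]
          field_simp

/-- A sequence of real numbers that grows at most geometrically. These are the coefficients for
which series of Mittag-Leffler type converge everywhere. -/
def GeometricallyBounded (m : ℕ → ℝ) : Prop :=
  ∃ C R : ℝ, 0 ≤ R ∧ ∀ n, |m n| ≤ C * R ^ n

theorem GeometricallyBounded.comp_add {m : ℕ → ℝ} (hm : GeometricallyBounded m) (k : ℕ) :
    GeometricallyBounded fun n => m (n + k) := by
  obtain ⟨C, R, hR, hC⟩ := hm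
  refine ⟨C * R ^ k, R, hR, fun n => (hC _).trans_eq ?_⟩
  ring

/-- The series `∑ mₙ xⁿ / Γ(n α + δ)` of Mittag-Leffler type. The second parameter records how many
fractional integrations have been applied to the series with `δ = 1`. -/
noncomputable def fracSeries (α δ : ℝ) (m : ℕ → ℝ) (x : ℝ) : ℝ :=
  ∑' n : ℕ, m n * x ^ n / Real.Gamma (n * α + δ)

variable {α δ : ℝ} {m : ℕ → ℝ}

theorem summable_norm_fracSeries (hα : 0 < α) (hδ : 0 < δ) (hm : GeometricallyBounded m) (x : ℝ) :
    Summable fun n : ℕ => ‖m n * x ^ n / Real.Gamma (n * α + δ)‖ := by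
  obtain ⟨C, R, hR, hC⟩ := hm
  refine Summable.of_nonneg_of_le (fun n => norm_nonneg _) (fun n => ?_)
    ((summable_pow_div_Gamma hα hδ (by positivity : 0 ≤ R * |x|)).mul_left C)
  have hΓ := Real.Gamma_pos_of_pos (by positivity : (0 : ℝ) < n * α + δ)
  rw [norm_div, norm_mul, norm_pow, Real.norm_of_nonneg hΓ.le, Real.norm_eq_abs, Real.norm_eq_abs,
    mul_pow, ← mul_div_assoc, ← mul_assoc]
  have := hC n
  gcongr

theorem summable_fracSeries (hα : 0 < α) (hδ : 0 < δ) (hm : GeometricallyBounded m) (x : ℝ) :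
    Summable fun n : ℕ => m n * x ^ n / Real.Gamma (n * α + δ) :=
  (summable_norm_fracSeries hα hδ hm x).of_norm

theorem continuous_fracSeries (hα : 0 < α) (hδ : 0 < δ) (hm : GeometricallyBounded m) :
    Continuous (fracSeries α δ m) := by
  refine continuous_iff_continuousAt.mpr fun x => ?_
  have hball : ContinuousOn (fracSeries α δ m) (Metric.ball 0 (|x| + 1)) := by
    refine continuousOn_tsum (fun n => by fun_prop)
      (summable_norm_fracSeries hα hδ hm (|x| + 1)) fun n y hy => ?_
    have hy' : ‖y‖ ≤ ‖|x| + 1‖ := (mem_ball_zero_iff.mp hy).le.trans (Real.le_norm_self _)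
    rw [norm_div, norm_div, norm_mul, norm_mul, norm_pow, norm_pow]
    gcongr
  refine hball.continuousAt (Metric.isOpen_ball.mem_nhds ?_)
  rw [mem_ball_zero_iff, Real.norm_eq_abs]
  exact lt_add_one _

theorem continuous_fracSeries_rpow (hα : 0 < α) (hδ : 0 < δ) (hm : GeometricallyBounded m) :
    Continuous fun t : ℝ => fracSeries α δ m (t ^ α) :=
  (continuous_fracSeries hα hδ hm).comp (Real.continuous_rpow_const hα.le)

theorem fracSeries_eq_sum_add (hα : 0 < α) (hδ : 0 < δ) (hm : GeometricallyBounded m) (k : ℕ)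
    (x : ℝ) :
    fracSeries α δ m x = ∑ n ∈ Finset.range k, m n * x ^ n / Real.Gamma (n * α + δ) +
      x ^ k * fracSeries α (δ + k * α) (fun n => m (n + k)) x := by
  rw [fracSeries, ← (summable_fracSeries hα hδ hm x).sum_add_tsum_nat_add k, fracSeries,
    ← tsum_mul_left]
  congr 1
  refine tsum_congr fun n => ?_
  have hΓ : ((n + k : ℕ) : ℝ) * α + δ = n * α + (δ + k * α) := by push_cast; ring
  rw [hΓ, pow_add]
  ring

theorem fracSeries_sum_mul {ι : Type*} (hα : 0 < α) (hδ : 0 < δ) (s : Finset ι) (a : ι → ℝ)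
    {p : ι → ℕ → ℝ} (hp : ∀ i ∈ s, GeometricallyBounded (p i)) (x : ℝ) :
    fracSeries α δ (fun n => ∑ i ∈ s, a i * p i n) x = ∑ i ∈ s, a i * fracSeries α δ (p i) x := by
  have hsum : ∀ i ∈ s, Summable fun n : ℕ => a i * (p i n * x ^ n / Real.Gamma (n * α + δ)) :=
    fun i hi => (summable_fracSeries hα hδ (hp i hi) x).mul_left _
  simp only [fracSeries, ← tsum_mul_left]
  rw [← Summable.tsum_finsetSum hsum]
  refine tsum_congr fun n => ?_
  simp only [Finset.sum_mul, Finset.sum_div, mul_assoc, mul_div_assoc]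

end FracSeries

section CaputoDerivative

open MeasureTheory Set

theorem absolutelyContinuousOnInterval_of_eq_add_integral {f g : ℝ → ℝ} {a b : ℝ}
    (hg : IntervalIntegrable g volume a b) (hfg : ∀ t ∈ uIcc a b, f t = f a + ∫ s in a..t, g s) :
    AbsolutelyContinuousOnInterval f a b := by
  refine (hg.absolutelyContinuousOnInterval_intervalIntegral left_mem_uIcc).congr' ?_
  filter_upwards [Filter.mem_inf_of_right (Filter.mem_principal_self _)] with E hE
  refine Finset.sum_congr rfl fun i hi => ?_
  rw [hfg _ (hE.1 i hi).1, hfg _ (hE.1 i hi).2, dist_add_left]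

theorem fracIntegral_tsum {γ t : ℝ} (hγ : 0 < γ) (ht : 0 ≤ t) {F : ℕ → ℝ → ℝ}
    (hF : ∀ n, IntervalIntegrable (fun s => (t - s) ^ (γ - 1) * F n s) volume 0 t)
    (hsum : Summable fun n => fracIntegral γ (fun s => |F n s|) t) :
    fracIntegral γ (fun s => ∑' n, F n s) t = ∑' n, fracIntegral γ (F n) t := by
  have hnorm : ∀ n, ∫ s in Ioc 0 t, ‖(t - s) ^ (γ - 1) * F n s‖ =
      Real.Gamma γ * fracIntegral γ (fun s => |F n s|) t := fun n => by
    rw [fracIntegral, mul_inv_cancel_left₀ (Real.Gamma_pos_of_pos hγ).ne',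
      intervalIntegral.integral_of_le ht]
    refine setIntegral_congr_fun measurableSet_Ioc fun s hs => ?_
    simp only [norm_mul, Real.norm_of_nonneg (Real.rpow_nonneg (sub_nonneg.mpr hs.2) _),
      Real.norm_eq_abs]
  have hswap := integral_tsum_of_summable_integral_norm
    (fun n => (intervalIntegrable_iff_integrableOn_Ioc_of_le ht).mp (hF n))
    (by simpa only [hnorm] using hsum.mul_left (Real.Gamma γ))
  simp only [fracIntegral, ← tsum_mul_left, intervalIntegral.integral_of_le ht]
  rw [← hswap, tsum_mul_left]

theorem fracIntegral_rpow_sub_one {b δ t : ℝ} (hb : 0 < b) (hδ : 0 < δ) (ht : 0 < t) :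
    fracIntegral b (fun s => s ^ (δ - 1)) t =
      Real.Gamma δ / Real.Gamma (δ + b) * t ^ (δ + b - 1) := by
  have hbeta := integral_sub_rpow_mul_sub_rpow hb hδ ht
  simp only [sub_zero] at hbeta
  have hΓ := (Real.Gamma_pos_of_pos hb).ne'
  rw [fracIntegral, hbeta, add_comm δ b]
  field_simp

variable {α δ b γ t : ℝ} {m : ℕ → ℝ}

theorem intervalIntegrable_sub_rpow_mul_fracSeries (hα : 0 < α) (hδ : 0 < δ) (hb : 0 < b)
    (hm : GeometricallyBounded m) (ht : 0 ≤ t) :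
    IntervalIntegrable (fun s => (t - s) ^ (b - 1) * (s ^ (δ - 1) * fracSeries α δ m (s ^ α)))
      volume 0 t := by
  rcases ht.eq_or_lt with rfl | ht
  · exact IntervalIntegrable.refl
  · have hkernel := intervalIntegrable_sub_rpow_mul_sub_rpow hb hδ ht
    simp only [sub_zero] at hkernel
    simpa only [mul_assoc] using
      hkernel.mul_continuousOn (continuous_fracSeries_rpow hα hδ hm).continuousOn

theorem fracIntegral_div_Gamma_mul_rpow (hα : 0 < α) (hδ : 0 < δ) (hb : 0 < b) (ht : 0 < t)
    (c : ℝ) (n : ℕ) :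
    fracIntegral b (fun s => c / Real.Gamma (n * α + δ) * s ^ (n * α + δ - 1)) t =
      t ^ (δ + b - 1) * (c * (t ^ α) ^ n / Real.Gamma (n * α + (δ + b))) := by
  have hexp : 0 < n * α + δ := by positivity
  have hpow : t ^ (n * α + δ + b - 1) = (t ^ α) ^ n * t ^ (δ + b - 1) := by
    rw [← Real.rpow_natCast, ← Real.rpow_mul ht.le, ← Real.rpow_add ht]
    ring_nf
  have hΓ := (Real.Gamma_pos_of_pos hexp).ne'
  rw [fracIntegral_const_mul, fracIntegral_rpow_sub_one hb hexp ht, hpow, add_assoc]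
  field_simp

theorem fracIntegral_rpow_mul_fracSeries (hα : 0 < α) (hδ : 0 < δ) (hb : 0 < b)
    (hm : GeometricallyBounded m) (ht : 0 < t) :
    fracIntegral b (fun s => s ^ (δ - 1) * fracSeries α δ m (s ^ α)) t =
      t ^ (δ + b - 1) * fracSeries α (δ + b) m (t ^ α) := by
  have hexp : ∀ n : ℕ, (0 : ℝ) < n * α + δ := fun n => by positivity
  calc fracIntegral b (fun s => s ^ (δ - 1) * fracSeries α δ m (s ^ α)) t
      = fracIntegral b
          (fun s => ∑' n : ℕ, m n / Real.Gamma (n * α + δ) * s ^ (n * α + δ - 1)) t := by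
        refine fracIntegral_congr ht.le fun s hs => ?_
        rw [fracSeries, ← tsum_mul_left]
        refine tsum_congr fun n => ?_
        rw [add_sub_assoc, Real.rpow_add hs.1, mul_comm (n : ℝ) α, Real.rpow_mul hs.1.le,
          Real.rpow_natCast]
        ring
    _ = ∑' n : ℕ, fracIntegral b
          (fun s => m n / Real.Gamma (n * α + δ) * s ^ (n * α + δ - 1)) t := by
        refine fracIntegral_tsum hb ht.le (fun n => ?_) ?_
        · have hkernel := intervalIntegrable_sub_rpow_mul_sub_rpow hb (hexp n) ht
          simp only [sub_zero] at hkernel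
          simpa only [mul_left_comm] using hkernel.const_mul (m n / Real.Gamma (n * α + δ))
        · refine ((summable_norm_fracSeries hα (add_pos hδ hb) hm (t ^ α)).mul_left
            (t ^ (δ + b - 1))).congr fun n => ?_
          have hΓ := Real.Gamma_pos_of_pos (by positivity : (0 : ℝ) < n * α + (δ + b))
          rw [norm_div, norm_mul, Real.norm_of_nonneg hΓ.le,
            Real.norm_of_nonneg (by positivity : 0 ≤ (t ^ α) ^ n),
            ← fracIntegral_div_Gamma_mul_rpow hα hδ hb ht]
          refine fracIntegral_congr ht.le fun s hs => ?_
          rw [abs_mul, abs_div, abs_of_pos (Real.Gamma_pos_of_pos (hexp n)),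
            abs_of_nonneg (Real.rpow_nonneg hs.1.le _), Real.norm_eq_abs]
    _ = t ^ (δ + b - 1) * fracSeries α (δ + b) m (t ^ α) := by
        simp only [fracIntegral_div_Gamma_mul_rpow hα hδ hb ht, fracSeries, tsum_mul_left]

theorem intervalIntegrable_rpow_mul_fracSeries (hα : 0 < α) (hδ : 0 < δ)
    (hm : GeometricallyBounded m) (ht : 0 ≤ t) :
    IntervalIntegrable (fun s => s ^ (δ - 1) * fracSeries α δ m (s ^ α)) volume 0 t := by
  simpa using intervalIntegrable_sub_rpow_mul_fracSeries hα hδ one_pos hm ht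

theorem fracSeries_rpow_eq_add_integral (hα : 0 < α) (hm : GeometricallyBounded m) (ht : 0 ≤ t) :
    fracSeries α 1 m (t ^ α) =
      m 0 + ∫ s in (0 : ℝ)..t, s ^ (α - 1) * fracSeries α α (fun n => m (n + 1)) (s ^ α) := by
  rw [fracSeries_eq_sum_add hα one_pos hm 1]
  rcases ht.eq_or_lt with rfl | ht
  · simp [Real.zero_rpow hα.ne']
  · rw [← fracIntegral_one,
      fracIntegral_rpow_mul_fracSeries hα hα one_pos (hm.comp_add 1) ht]
    simp [add_comm]

theorem absolutelyContinuousOnInterval_fracSeries_rpow (hα : 0 < α) (hm : GeometricallyBounded m)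
    (ht : 0 ≤ t) :
    AbsolutelyContinuousOnInterval (fun s => fracSeries α 1 m (s ^ α)) 0 t := by
  refine absolutelyContinuousOnInterval_of_eq_add_integral
    (intervalIntegrable_rpow_mul_fracSeries hα hα (hm.comp_add 1) ht) fun s hs => ?_
  rw [uIcc_of_le ht] at hs
  rw [fracSeries_rpow_eq_add_integral hα hm hs.1, fracSeries_rpow_eq_add_integral hα hm le_rfl,
    intervalIntegral.integral_same, add_zero]

theorem hasDerivAt_fracSeries_rpow (hα : 0 < α) (hm : GeometricallyBounded m) (ht : 0 < t) :
    HasDerivAt (fun s => fracSeries α 1 m (s ^ α))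
      (t ^ (α - 1) * fracSeries α α (fun n => m (n + 1)) (t ^ α)) t := by
  have hcont : ContinuousOn
      (fun s : ℝ => s ^ (α - 1) * fracSeries α α (fun n => m (n + 1)) (s ^ α)) (Ioi 0) :=
    (continuousOn_id.rpow_const fun s hs => Or.inl (ne_of_gt hs)).mul
      (continuous_fracSeries_rpow hα hα (hm.comp_add 1)).continuousOn
  have hint := intervalIntegral.integral_hasDerivAt_right
    (intervalIntegrable_rpow_mul_fracSeries hα hα (hm.comp_add 1) ht.le)
    (hcont.stronglyMeasurableAtFilter isOpen_Ioi t ht) (hcont.continuousAt (Ioi_mem_nhds ht))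
  refine (hint.const_add (m 0)).congr_of_eventuallyEq ?_
  filter_upwards [Ioi_mem_nhds ht] with s hs
  exact fracSeries_rpow_eq_add_integral hα hm (le_of_lt hs)

theorem caputoDerivExists_fracSeries_rpow (hα : 0 < α) (hγ : γ ≤ 1) (hm : GeometricallyBounded m)
    (ht : 0 < t) :
    CaputoDerivExists γ (fun s => fracSeries α 1 m (s ^ α)) t := by
  rw [CaputoDerivExists]
  split_ifs with hγ1
  · exact (hasDerivAt_fracSeries_rpow hα hm ht).differentiableAt
  · refine (intervalIntegrable_sub_rpow_mul_fracSeries hα hα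
      (sub_pos.mpr (lt_of_le_of_ne hγ hγ1)) (hm.comp_add 1) ht.le).congr fun s hs => ?_
    rw [uIoc_of_le ht.le] at hs
    rw [(hasDerivAt_fracSeries_rpow hα hm hs.1).deriv, sub_sub_cancel_left,
      Real.rpow_neg (sub_nonneg.mpr hs.2), div_eq_inv_mul]

theorem caputoDeriv_fracSeries_rpow (hα : 0 < α) (hγ : γ ≤ 1) (hm : GeometricallyBounded m)
    (ht : 0 < t) :
    caputoDeriv γ (fun s => fracSeries α 1 m (s ^ α)) t =
      t ^ (α - γ) * fracSeries α (α + (1 - γ)) (fun n => m (n + 1)) (t ^ α) := by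
  rcases eq_or_ne γ 1 with rfl | hγ1
  · rw [caputoDeriv_one, (hasDerivAt_fracSeries_rpow hα hm ht).deriv, sub_self, add_zero]
  · rw [caputoDeriv_eq_fracIntegral hγ1 ht.le,
      fracIntegral_congr ht.le fun s hs => (hasDerivAt_fracSeries_rpow hα hm hs.1).deriv,
      fracIntegral_rpow_mul_fracSeries hα hα (sub_pos.mpr (lt_of_le_of_ne hγ hγ1))
        (hm.comp_add 1) ht]
    ring_nf

theorem caputoDeriv_natCast_mul_fracSeries_rpow {k : ℕ} (hα : 0 < α) (hk : 0 < k)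
    (hkα : k * α ≤ 1) (hm : GeometricallyBounded m) (hm0 : ∀ n, 0 < n → n < k → m n = 0)
    (ht : 0 < t) :
    caputoDeriv (k * α) (fun s => fracSeries α 1 m (s ^ α)) t =
      fracSeries α 1 (fun n => m (n + k)) (t ^ α) := by
  obtain ⟨l, rfl⟩ := Nat.exists_eq_add_one.mpr hk
  have hzero : ∀ n ∈ Finset.range l, m (n + 1) * (t ^ α) ^ n /
      Real.Gamma (n * α + (α + (1 - (l + 1 : ℕ) * α))) = 0 := fun n hn => by
    rw [hm0 (n + 1) n.succ_pos (Nat.succ_lt_succ (Finset.mem_range.mp hn)), zero_mul, zero_div]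
  have horder : α + (1 - (l + 1 : ℕ) * α) + l * α = 1 := by push_cast; ring
  have hpow : t ^ (α - (l + 1 : ℕ) * α) * (t ^ α) ^ l = 1 := by
    rw [← Real.rpow_natCast, ← Real.rpow_mul ht.le, ← Real.rpow_add ht, ← Real.rpow_zero t]
    congr 1
    push_cast
    ring
  rw [caputoDeriv_fracSeries_rpow hα hkα hm ht,
    fracSeries_eq_sum_add hα (by linarith) (hm.comp_add 1) l, Finset.sum_eq_zero hzero, zero_add,
    ← mul_assoc, hpow, one_mul, horder]
  simp only [add_assoc]

end CaputoDerivative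

section Recurrence

/-- The recurrence satisfied by the coefficients `m n` of a solution
`∑ m n t ^ (n α) / Γ(1 + n α)` of the linear system whose `i`-th equation has order `k i * α`. -/
structure IsMixedIndexRecurrence {ι R : Type*} [Fintype ι] [NonUnitalNonAssocSemiring R]
    (k : ι → ℕ) (A : Matrix ι ι R) (z : ι → R) (m : ℕ → ι → R) : Prop where
  zero : m 0 = z
  eq_zero_of_lt : ∀ i n, 0 < n → n < k i → m n i = 0
  add : ∀ i n, m (n + k i) i = A.mulVec (m n) i

namespace IsMixedIndexRecurrence

variable {ι : Type*} [Fintype ι] {k : ι → ℕ}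

theorem norm_le {A : Matrix ι ι ℝ} {z : ι → ℝ} {m : ℕ → ι → ℝ}
    (h : IsMixedIndexRecurrence k A z m) (hk : ∀ i, 0 < k i) {L : ℝ} (hL1 : 1 ≤ L)
    (hL : ∀ v, ‖A.mulVec v‖ ≤ L * ‖v‖) (n : ℕ) :
    ‖m n‖ ≤ ‖z‖ * L ^ n := by
  induction n using Nat.strong_induction_on with
  | _ n ih =>
    rcases n.eq_zero_or_pos with rfl | hn
    · simp [h.zero]
    refine (pi_norm_le_iff_of_nonneg (by positivity)).mpr fun i => ?_
    rcases lt_or_ge n (k i) with hnk | hnk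
    · rw [h.eq_zero_of_lt i n hn hnk, norm_zero]
      positivity
    · obtain ⟨l, rfl⟩ := Nat.exists_eq_add_of_le' hnk
      have hlt : l < l + k i := Nat.lt_add_of_pos_right (hk i)
      calc ‖m (l + k i) i‖ ≤ ‖A.mulVec (m l)‖ := h.add i l ▸ norm_le_pi_norm _ i
        _ ≤ L * (‖z‖ * L ^ l) := (hL _).trans (by gcongr; exact ih l hlt)
        _ = ‖z‖ * L ^ (l + 1) := by ring
        _ ≤ ‖z‖ * L ^ (l + k i) := by gcongr; exact hk i

theorem geometricallyBounded {A : Matrix ι ι ℝ} {z : ι → ℝ} {m : ℕ → ι → ℝ}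
    (h : IsMixedIndexRecurrence k A z m) (hk : ∀ i, 0 < k i) (i : ι) :
    GeometricallyBounded fun n => m n i := by
  set Φ := LinearMap.toContinuousLinearMap A.mulVecLin
  have hL : ∀ v, ‖A.mulVec v‖ ≤ max 1 ‖Φ‖ * ‖v‖ := fun v =>
    (Φ.le_opNorm v).trans (by gcongr; exact le_max_right _ _)
  exact ⟨‖z‖, max 1 ‖Φ‖, by positivity, fun n =>
    (norm_le_pi_norm (m n) i).trans (h.norm_le hk (le_max_left _ _) hL n)⟩

theorem exists_of_map {R S : Type*} [NonAssocSemiring R] [NonAssocSemiring S] {φ : R →+* S}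
    (hφ : Function.Injective φ) {A : Matrix ι ι R} {z : ι → R} {p : ℕ → ι → S}
    (h : IsMixedIndexRecurrence k (A.map φ) (fun i => φ (z i)) p) (hk : ∀ i, 0 < k i) :
    ∃ m : ℕ → ι → R, IsMixedIndexRecurrence k A z m ∧ ∀ n i, φ (m n i) = p n i := by
  have hmap : ∀ v : ι → R, ∀ i, φ (A.mulVec v i) = (A.map φ).mulVec (fun j => φ (v j)) i :=
    fun v i => by simp [Matrix.mulVec, dotProduct]
  have hrange : ∀ n, ∃ v : ι → R, (fun i => φ (v i)) = p n := fun n => by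
    induction n using Nat.strong_induction_on with
    | _ n ih =>
      rcases n.eq_zero_or_pos with rfl | hn
      · exact ⟨z, h.zero.symm⟩
      suffices hcomp : ∀ i, ∃ x, φ x = p n i by
        choose v hv using hcomp
        exact ⟨v, funext hv⟩
      intro i
      rcases lt_or_ge n (k i) with hnk | hnk
      · exact ⟨0, by rw [map_zero, h.eq_zero_of_lt i n hn hnk]⟩
      · obtain ⟨l, rfl⟩ := Nat.exists_eq_add_of_le' hnk
        obtain ⟨v, hv⟩ := ih l (Nat.lt_add_of_pos_right (hk i))
        exact ⟨A.mulVec v i, by rw [hmap, hv, h.add]⟩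
  choose m hm using hrange
  have hm' : ∀ n i, φ (m n i) = p n i := fun n => congrFun (hm n)
  refine ⟨m, ⟨?_, fun i n hn hnk => hφ ?_, fun i n => hφ ?_⟩, hm'⟩
  · exact funext fun i => hφ (by rw [hm', h.zero])
  · rw [hm', h.eq_zero_of_lt i n hn hnk, map_zero]
  · rw [hm', h.add, hmap, hm]

theorem isMixedIndexSolution {k : Fin 2 → ℕ} {α : ℝ} {A : Matrix (Fin 2) (Fin 2) ℝ}
    {z : Fin 2 → ℝ} {m : ℕ → Fin 2 → ℝ} (h : IsMixedIndexRecurrence k A z m) (hα : 0 < α)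
    (hk : ∀ i, 0 < k i) (hkα : ∀ i, k i * α ≤ 1) :
    IsMixedIndexSolution (fun i => k i * α) A z
      (fun t i => fracSeries α 1 (fun n => m n i) (t ^ α)) where
  initial := funext fun i => by
    rw [fracSeries_rpow_eq_add_integral hα (h.geometricallyBounded hk i) le_rfl,
      intervalIntegral.integral_same, add_zero, h.zero]
  absolutelyContinuous i T hT :=
    absolutelyContinuousOnInterval_fracSeries_rpow hα (h.geometricallyBounded hk i) hT
  derivExists i t ht :=
    caputoDerivExists_fracSeries_rpow hα (hkα i) (h.geometricallyBounded hk i) ht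
  equation i t ht := by
    rw [caputoDeriv_natCast_mul_fracSeries_rpow hα (hk i) (hkα i) (h.geometricallyBounded hk i)
      (h.eq_zero_of_lt i) ht]
    simp only [h.add, Matrix.mulVec, dotProduct]
    exact fracSeries_sum_mul hα one_pos Finset.univ (A i)
      (fun j _ => h.geometricallyBounded hk j) (t ^ α)

end IsMixedIndexRecurrence

end Recurrence

section PartialFractions

variable {𝕜 ι : Type*} [Field 𝕜] [Fintype ι] {c e lam : ι → 𝕜} {k : ℕ} {p : 𝕜[X]}

/-- The `n`-th moment `∑ j, c j * lam j ^ n` of the weights `c` placed at the nodes `lam`; it is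
the coefficient of `w⁻¹ ^ (n + 1)` in the expansion of `∑ j, c j / (w - lam j)` at `w = ∞`. -/
def powerMoment (c lam : ι → 𝕜) (n : ℕ) : 𝕜 :=
  ∑ j, c j * lam j ^ n

/-- The polynomial part of `w ^ k * ∑ j, c j / (w - lam j)`. -/
noncomputable def polynomialPart (c lam : ι → 𝕜) (k : ℕ) : 𝕜[X] :=
  ∑ n ∈ Finset.range k, C (powerMoment c lam (k - 1 - n)) * X ^ n

theorem coeff_polynomialPart {n : ℕ} (hn : n < k) :
    (polynomialPart c lam k).coeff n = powerMoment c lam (k - 1 - n) := by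
  simp [polynomialPart, coeff_X_pow, hn.not_ge]

theorem pow_mul_sum_div_sub {w : 𝕜} (hw : ∀ j, w ≠ lam j) :
    w ^ k * ∑ j, c j / (w - lam j) =
      (polynomialPart c lam k).eval w + ∑ j, c j * lam j ^ k / (w - lam j) := by
  have hgeom : ∀ j, w ^ k / (w - lam j) =
      ∑ n ∈ Finset.range k, w ^ n * lam j ^ (k - 1 - n) + lam j ^ k / (w - lam j) := fun j => by
    have hwj : w - lam j ≠ 0 := sub_ne_zero.mpr (hw j)
    rw [eq_comm, ← eq_sub_iff_add_eq, ← sub_div, eq_div_iff hwj, geom_sum₂_mul]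
  calc w ^ k * ∑ j, c j / (w - lam j) = ∑ j, c j * (w ^ k / (w - lam j)) := by
        rw [Finset.mul_sum]
        exact Finset.sum_congr rfl fun j _ => by ring
    _ = ∑ n ∈ Finset.range k, powerMoment c lam (k - 1 - n) * w ^ n +
          ∑ j, c j * lam j ^ k / (w - lam j) := by
        simp only [hgeom, mul_add, Finset.sum_add_distrib, powerMoment, Finset.mul_sum,
          Finset.sum_mul, mul_div_assoc]
        rw [Finset.sum_comm]
        simp only [mul_assoc, mul_comm (w ^ _)]
    _ = _ := by simp [polynomialPart, eval_finsetSum]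

theorem eq_zero_of_eval_eq_sum_div_sub [Infinite 𝕜]
    (h : ∀ w, (∀ j, w ≠ lam j) → p.eval w = ∑ j, c j / (w - lam j)) : p = 0 := by
  classical
  let q : 𝕜[X] := ∑ j, C (c j) * Lagrange.nodal (Finset.univ.erase j) lam
  have hpq : p * Lagrange.nodal Finset.univ lam = q := by
    refine eq_of_infinite_eval_eq _ _
      ((Set.finite_range lam).infinite_compl.mono fun w hw => ?_)
    have hw : ∀ j, w ≠ lam j := fun j hj => hw ⟨j, hj.symm⟩
    simp only [Set.mem_ofPred_eq, q, eval_mul, h w hw, Lagrange.eval_nodal, eval_finsetSum, eval_C,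
      Finset.sum_mul]
    refine Finset.sum_congr rfl fun j _ => ?_
    rw [← Finset.mul_prod_erase _ _ (Finset.mem_univ j), ← mul_assoc,
      div_mul_cancel₀ _ (sub_ne_zero.mpr (hw j))]
  have hq : q.degree < (Lagrange.nodal Finset.univ lam).degree := by
    rw [Lagrange.degree_nodal, ← mem_degreeLT]
    refine Submodule.sum_mem _ fun j _ => ?_
    rw [C_mul']
    refine Submodule.smul_mem _ _ (mem_degreeLT.mpr ?_)
    rw [Lagrange.degree_nodal]
    exact_mod_cast Finset.card_erase_lt_of_mem (Finset.mem_univ j)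
  by_contra hp
  refine hq.not_ge ?_
  rw [← hpq, degree_mul]
  exact le_add_of_nonneg_left (zero_le_degree_iff.mpr hp)

theorem polynomialPart_eq [Infinite 𝕜]
    (h : ∀ w, (∀ j, w ≠ lam j) →
      w ^ k * ∑ j, c j / (w - lam j) = p.eval w + ∑ j, e j / (w - lam j)) :
    polynomialPart c lam k = p := by
  refine sub_eq_zero.mp (eq_zero_of_eval_eq_sum_div_sub (c := fun j => e j - c j * lam j ^ k)
    (lam := lam) fun w hw => ?_)
  have := (pow_mul_sum_div_sub hw).symm.trans (h w hw)
  simp only [sub_div, Finset.sum_sub_distrib, eval_sub]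
  linear_combination this

theorem powerMoment_of_lt [Infinite 𝕜]
    (h : ∀ w, (∀ j, w ≠ lam j) →
      w ^ k * ∑ j, c j / (w - lam j) = p.eval w + ∑ j, e j / (w - lam j))
    {n : ℕ} (hn : n < k) : powerMoment c lam n = p.coeff (k - 1 - n) := by
  rw [← polynomialPart_eq h, coeff_polynomialPart (by omega)]
  congr 1
  omega

theorem powerMoment_add [Infinite 𝕜]
    (h : ∀ w, (∀ j, w ≠ lam j) →
      w ^ k * ∑ j, c j / (w - lam j) = p.eval w + ∑ j, e j / (w - lam j)) (n : ℕ) :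
    powerMoment c lam (n + k) = powerMoment e lam n := by
  have hmul : ∀ w, (∀ j, w ≠ lam j) → w ^ (n + 1 + k) * ∑ j, c j / (w - lam j) =
      (X ^ (n + 1) * p + polynomialPart e lam (n + 1)).eval w +
        ∑ j, e j * lam j ^ (n + 1) / (w - lam j) := fun w hw => by
    rw [pow_add, mul_assoc, h w hw, mul_add, pow_mul_sum_div_sub hw]
    simp only [eval_add, eval_mul, eval_pow, eval_X]
    ring
  have hcoeff : n + 1 + k - 1 - (n + k) = 0 := by omega
  rw [powerMoment_of_lt hmul (by omega), hcoeff, coeff_add, coeff_polynomialPart n.succ_pos]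
  simp [pow_succ, mul_assoc, mul_coeff_zero]

theorem powerMoment_eq_zero [Infinite 𝕜]
    (h : ∀ w, (∀ j, w ≠ lam j) → ∑ j, c j / (w - lam j) = 0) (n : ℕ) :
    powerMoment c lam n = 0 := by
  have hmul : ∀ w, (∀ j, w ≠ lam j) → w ^ (n + 1) * ∑ j, c j / (w - lam j) =
      (0 : 𝕜[X]).eval w + ∑ j, (0 : ι → 𝕜) j / (w - lam j) := fun w hw => by simp [h w hw]
  simpa using powerMoment_of_lt hmul n.lt_succ_self

theorem existsUnique_sum_div_sub_eq_eval_div_prod [Infinite 𝕜] {n : ℕ} {lam : Fin n → 𝕜}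
    (hlam : Function.Injective lam) (hp : p.degree < n) :
    ∃! c : Fin n → 𝕜, ∀ w, (∀ j, w ≠ lam j) →
      ∑ j, c j / (w - lam j) = p.eval w / ∏ j, (w - lam j) := by
  refine existsUnique_of_exists_of_unique
    ⟨fun j => Lagrange.nodalWeight Finset.univ lam j * p.eval (lam j), fun w hw => ?_⟩
    fun c d hc hd => sub_eq_zero.mp ?_
  · have hinterp : p.eval w = (∏ j, (w - lam j)) *
        ∑ j, Lagrange.nodalWeight Finset.univ lam j * (w - lam j)⁻¹ * p.eval (lam j) := by
      conv_lhs => rw [Lagrange.eq_interpolate (f := p) (s := Finset.univ) (v := lam) hlam.injOn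
        (by simpa using hp)]
      rw [Lagrange.eval_interpolate_not_at_node _ fun j _ => hw j, Lagrange.eval_nodal]
    rw [hinterp, mul_div_cancel_left₀ _
      (Finset.prod_ne_zero_iff.mpr fun j _ => sub_ne_zero.mpr (hw j))]
    exact Finset.sum_congr rfl fun j _ => by ring
  · refine Matrix.eq_zero_of_forall_pow_sum_mul_pow_eq_zero hlam fun i =>
      powerMoment_eq_zero (c := c - d) (fun w hw => ?_) i
    simp only [Pi.sub_apply, sub_div, Finset.sum_sub_distrib, hc w hw, hd w hw, sub_self]

theorem exists_eq_prod_X_sub_C_of_monic (hp : p.Splits) (hm : p.Monic) {n : ℕ}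
    (hn : p.natDegree = n) : ∃ r : Fin n → 𝕜, p = ∏ j, (X - C (r j)) := by
  have hlen : p.roots.toList.length = n := by
    rw [Multiset.length_toList, ← hp.natDegree_eq_card_roots, hn]
  subst hlen
  refine ⟨p.roots.toList.get, ?_⟩
  conv_lhs => rw [hp.eq_prod_roots_of_monic hm, ← Multiset.coe_toList p.roots]
  rw [Multiset.map_coe, Multiset.prod_coe]
  exact (Fin.prod_univ_fun_getElem _ _).symm

end PartialFractions

section CharacteristicPolynomial

variable {A : Matrix (Fin 2) (Fin 2) ℝ} {z : Fin 2 → ℝ} {K : ℕ} {lam : Fin (K + 1) → ℂ}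
  {c : Fin (K + 1) → Fin 2 → ℂ}

theorem natDegree_detPoly (A : Matrix (Fin 2) (Fin 2) ℝ) (hK : 0 < K) :
    (detPoly A K).natDegree = K + 1 := by
  rw [detPoly]
  compute_degree!
  simp [hK.ne']

theorem monic_detPoly (A : Matrix (Fin 2) (Fin 2) ℝ) (hK : 0 < K) : (detPoly A K).Monic := by
  rw [Monic, leadingCoeff, natDegree_detPoly A hK]
  simp [detPoly, coeff_C, hK.ne']

theorem exists_isRootList (A : Matrix (Fin 2) (Fin 2) ℝ) (hK : 0 < K) :
    ∃ lam : Fin (K + 1) → ℂ, IsRootList A K lam :=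
  exists_eq_prod_X_sub_C_of_monic (IsAlgClosed.splits _) (monic_detPoly A hK)
    (natDegree_detPoly A hK)

/-- The numerators of the two components of the rational function expanded in
`IsPartialFraction`. -/
noncomputable def partialFractionNumerator (A : Matrix (Fin 2) (Fin 2) ℝ) (z : Fin 2 → ℝ)
    (K : ℕ) (i : Fin 2) : ℂ[X] :=
  C (z i : ℂ) * X ^ K + C ((z 1 : ℂ) * ![(A 0 1 : ℂ), -(A 0 0 : ℂ)] i) * X ^ (K - 1) +
    C ((z 0 : ℂ) * ![-(A 1 1 : ℂ), (A 1 0 : ℂ)] i)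

theorem degree_partialFractionNumerator_lt (i : Fin 2) :
    (partialFractionNumerator A z K i).degree < (K + 1 : ℕ) := by
  refine (degree_le_of_natDegree_le (n := K) ?_).trans_lt (by exact_mod_cast K.lt_succ_self)
  rw [partialFractionNumerator]
  compute_degree!

theorem X_pow_mul_partialFractionNumerator (hK : 0 < K) (i : Fin 2) :
    X ^ ![1, K] i * partialFractionNumerator A z K i =
      C (z i : ℂ) * X ^ (![1, K] i - 1) * detPoly A K +
        ∑ j, C (A i j : ℂ) * partialFractionNumerator A z K j := by
  obtain ⟨k, rfl⟩ := Nat.exists_eq_add_one.mpr hK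
  rw [detPoly, Matrix.det_fin_two, Fin.sum_univ_two]
  fin_cases i <;> simp [partialFractionNumerator] <;> ring

namespace IsRootList

theorem eval_detPoly (h : IsRootList A K lam) (w : ℂ) :
    (detPoly A K).eval w = ∏ j, (w - lam j) := by
  rw [h]; simp [eval_prod]

theorem eval_detPoly_ne_zero_iff (h : IsRootList A K lam) {w : ℂ} :
    (detPoly A K).eval w ≠ 0 ↔ ∀ j, w ≠ lam j := by
  simp [h.eval_detPoly, Finset.prod_ne_zero_iff, sub_ne_zero]

theorem isPartialFraction_iff (h : IsRootList A K lam) :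
    IsPartialFraction A z K lam c ↔ ∀ i w, (∀ j, w ≠ lam j) →
      ∑ j, c j i / (w - lam j) =
        (partialFractionNumerator A z K i).eval w / ∏ j, (w - lam j) := by
  rw [forall_comm]
  refine forall_congr' fun w => ?_
  rw [forall_comm, h.eval_detPoly_ne_zero_iff]
  refine forall_congr' fun _ => funext_iff.trans (forall_congr' fun i => Eq.congr ?_ ?_)
  · simp [Finset.sum_apply, div_eq_inv_mul]
  · rw [h.eval_detPoly]
    fin_cases i <;> simp [partialFractionNumerator] <;> ring

theorem existsUnique_isPartialFraction (h : IsRootList A K lam) (hlam : Function.Injective lam) :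
    ∃! c : Fin (K + 1) → Fin 2 → ℂ, IsPartialFraction A z K lam c := by
  choose c hc hunique using fun i => existsUnique_sum_div_sub_eq_eval_div_prod hlam
    (degree_partialFractionNumerator_lt (A := A) (z := z) (K := K) i)
  refine ⟨fun j i => c i j, h.isPartialFraction_iff.mpr hc, fun d hd => ?_⟩
  funext j i
  exact congrFun (hunique i (fun j => d j i) (h.isPartialFraction_iff.mp hd i)) j

theorem pow_mul_sum_div_sub_eq (h : IsRootList A K lam) (hK : 0 < K)
    (hc : IsPartialFraction A z K lam c) (i : Fin 2) {w : ℂ} (hw : ∀ j, w ≠ lam j) :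
    w ^ ![1, K] i * ∑ j, c j i / (w - lam j) =
      (C (z i : ℂ) * X ^ (![1, K] i - 1)).eval w +
        ∑ j, (A.map Complex.ofRealHom).mulVec (c j) i / (w - lam j) := by
  have hD := Finset.prod_ne_zero_iff.mpr fun j (_ : j ∈ Finset.univ) => sub_ne_zero.mpr (hw j)
  have hmulVec : ∑ j, (A.map Complex.ofRealHom).mulVec (c j) i / (w - lam j) =
      ∑ l, (A i l : ℂ) * ∑ j, c j l / (w - lam j) := by
    simp only [Matrix.mulVec, dotProduct, Matrix.map_apply, Complex.ofRealHom_eq_coe,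
      Finset.sum_div, Finset.mul_sum, mul_div_assoc]
    exact Finset.sum_comm
  have hnum := congrArg (eval w) (X_pow_mul_partialFractionNumerator (A := A) (z := z) hK i)
  rw [eval_add, eval_mul, eval_pow, eval_X, eval_mul, h.eval_detPoly, eval_finsetSum] at hnum
  rw [hmulVec]
  simp only [h.isPartialFraction_iff.mp hc _ w hw]
  rw [← mul_div_assoc, hnum, add_div, mul_div_cancel_right₀ _ hD, Finset.sum_div]
  simp only [eval_mul, eval_C, mul_div_assoc]

theorem isMixedIndexRecurrence (h : IsRootList A K lam) (hK : 0 < K)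
    (hc : IsPartialFraction A z K lam c) :
    IsMixedIndexRecurrence ![1, K] (A.map Complex.ofRealHom) (fun i => Complex.ofRealHom (z i))
      (fun n i => powerMoment (fun j => c j i) lam n) := by
  have hk : ∀ i, 0 < ![1, K] i := Fin.forall_fin_two.mpr ⟨one_pos, hK⟩
  have hlaplace := fun i w hw => h.pow_mul_sum_div_sub_eq hK hc i (w := w) hw
  refine ⟨funext fun i => ?_, fun i n hn hnk => ?_, fun i n => ?_⟩
  · rw [powerMoment_of_lt (hlaplace i) (hk i)]
    simp
  · rw [powerMoment_of_lt (hlaplace i) hnk, coeff_C_mul_X_pow, if_neg (by omega)]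
  · rw [powerMoment_add (hlaplace i)]
    simp only [powerMoment, Matrix.mulVec, dotProduct, Finset.sum_mul, Finset.mul_sum, mul_assoc]
    exact Finset.sum_comm

end IsRootList

end CharacteristicPolynomial

section MittagLeffler

variable {α : ℝ}

theorem summable_mittagLeffler (hα : 0 < α) (w : ℂ) :
    Summable fun n : ℕ => w ^ n / ((Real.Gamma (1 + (n : ℝ) * α) : ℝ) : ℂ) := by
  refine Summable.of_norm ((summable_pow_div_Gamma hα one_pos (norm_nonneg w)).congr fun n => ?_)
  rw [norm_div, norm_pow, add_comm (1 : ℝ), Complex.norm_real, Real.norm_of_nonneg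
    (Real.Gamma_pos_of_pos (by positivity)).le]

theorem ofReal_fracSeries_eq_sum_mittagLeffler (hα : 0 < α) {ι : Type*} [Fintype ι]
    {c lam : ι → ℂ} {m : ℕ → ℝ} (hm : ∀ n, (m n : ℂ) = powerMoment c lam n) (x : ℝ) :
    (fracSeries α 1 m x : ℂ) = ∑ j, c j * mittagLeffler α (lam j * x) := by
  simp only [mittagLeffler, ← tsum_mul_left]
  rw [← Summable.tsum_finsetSum fun j _ => (summable_mittagLeffler hα _).mul_left (c j),
    fracSeries, Complex.ofReal_tsum]
  refine tsum_congr fun n => ?_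
  push_cast
  rw [hm, powerMoment, Finset.sum_mul, Finset.sum_div]
  refine Finset.sum_congr rfl fun j _ => ?_
  rw [add_comm (1 : ℝ), mul_pow]
  ring

end MittagLeffler

theorem corollary16_general (α : ℝ) (hα_pos : 0 < α)
    (K : ℕ) (hK : 0 < K) (hβ : (K : ℝ) * α ≤ 1)
    (A : Matrix (Fin 2) (Fin 2) ℝ) (z : Fin 2 → ℝ) :
    (∃ lam : Fin (K + 1) → ℂ, IsRootList A K lam) ∧
    ∀ lam : Fin (K + 1) → ℂ, IsRootList A K lam →
      (Function.Injective lam →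
        ∃! c : Fin (K + 1) → Fin 2 → ℂ, IsPartialFraction A z K lam c) ∧
      ∀ c : Fin (K + 1) → Fin 2 → ℂ, IsPartialFraction A z K lam c →
        (∃ y : ℝ → Fin 2 → ℝ, IsMixedIndexSolution ![α, (K : ℝ) * α] A z y) ∧
        ∀ y : ℝ → Fin 2 → ℝ, IsMixedIndexSolution ![α, (K : ℝ) * α] A z y →
          ∀ t : ℝ, 0 ≤ t → ∀ i : Fin 2,
            (y t i : ℂ) =
              ∑ j : Fin (K + 1), c j i * mittagLeffler α (lam j * ((t ^ α : ℝ) : ℂ)) := by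
  refine ⟨exists_isRootList A hK, fun lam hlam => ⟨hlam.existsUnique_isPartialFraction,
    fun c hc => ?_⟩⟩
  have horder : ![α, (K : ℝ) * α] = fun i => ((![1, K] i : ℕ) : ℝ) * α := by
    funext i; fin_cases i <;> simp
  have hk : ∀ i, 0 < ![1, K] i := Fin.forall_fin_two.mpr ⟨one_pos, hK⟩
  have hkα : ∀ i, ((![1, K] i : ℕ) : ℝ) * α ≤ 1 := fun i =>
    (mul_le_mul_of_nonneg_right (by fin_cases i <;> simp [Nat.succ_le_of_lt hK]) hα_pos.le).trans hβ
  obtain ⟨m, hm, hmc⟩ := IsMixedIndexRecurrence.exists_of_map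
    (φ := Complex.ofRealHom) Complex.ofReal_injective (hlam.isMixedIndexRecurrence hK hc) hk
  have hsol := hm.isMixedIndexSolution hα_pos hk hkα
  rw [horder]
  refine ⟨⟨_, hsol⟩, fun y hy t ht i => ?_⟩
  rw [hy.eqOn hsol (fun i => mul_pos (Nat.cast_pos.mpr (hk i)) hα_pos) hkα ht]
  exact ofReal_fracSeries_eq_sum_mittagLeffler hα_pos (fun n => hmc n i) (t ^ α)

theorem corollary16 (α : ℝ) (hα_rat : ∃ r : ℚ, (r : ℝ) = α) (hα_pos : 0 < α)
    (K : ℕ) (hK : 0 < K) (hβ : (K : ℝ) * α ≤ 1)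
    (A : Matrix (Fin 2) (Fin 2) ℝ) (z : Fin 2 → ℝ) :
    (∃ lam : Fin (K + 1) → ℂ, IsRootList A K lam) ∧
    ∀ lam : Fin (K + 1) → ℂ, IsRootList A K lam →
      (Function.Injective lam →
        ∃! c : Fin (K + 1) → Fin 2 → ℂ, IsPartialFraction A z K lam c) ∧
      ∀ c : Fin (K + 1) → Fin 2 → ℂ, IsPartialFraction A z K lam c →
        (∃ y : ℝ → Fin 2 → ℝ, IsMixedIndexSolution ![α, (K : ℝ) * α] A z y) ∧
        ∀ y : ℝ → Fin 2 → ℝ, IsMixedIndexSolution ![α, (K : ℝ) * α] A z y →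
          ∀ t : ℝ, 0 ≤ t → ∀ i : Fin 2,
            (y t i : ℂ) =
              ∑ j : Fin (K + 1), c j i * mittagLeffler α (lam j * ((t ^ α : ℝ) : ℂ)) :=
  corollary16_general α hα_pos K hK hβ A z
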